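/- Consider the uniform random recursive tree: start at time $0$ with the single vertex $v_0$ and no edges; for each $n\ge 1$, given the tree on $v_0,\dots,v_{n-1}$, add the vertex $v_n$ and one edge joining $v_n$ to a vertex chosen uniformly at random among $v_0,\dots,v_{n-1}$. (This is the generalized attachment model in which every new vertex brings one edge and the attachment function is $f(k)=1$ for all $k\ge 0$.) For $0\le i\le n$ let $d_i(n)$ be the degree (in-degree plus out-degree) of $v_i$ in the tree on $v_0,\dots,v_n$, and let $$d_{\max}(n)=\max_{0\le i\le n} d_i(n),\qquad \mathcal I^*_n=\min\{0\le i\le n:\ d_i(n)\ge d_j(n)\ \text{for all } 0\le j\le n\}$$ be the maximal degree and the index of the oldest vertex of maximal degree. Then, as $n\to\infty$, $$\frac{\log \mathcal I^*_n}{\log n}\ \xrightarrow{P}\ 1-\frac{1}{2\ln 2}\qquad\text{and}\qquad \frac{d_{\max}(n)}{\log n}\ \xrightarrow{P}\ \frac{1}{\ln 2},$$ where $\xrightarrow{P}$ denotes convergence in probability. -/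

import Mathlib

open MeasureTheory Filter

/-- A growing tree on the vertices `v_0, v_1, v_2, …` is recorded by `e : ℕ → ℕ`: for `k ≥ 1`, the
`k`-th edge is directed from the new vertex `v_k` to the vertex `v_(e k)` (the value `e 0` is
irrelevant).  After `n` edges the tree has the vertices `v_0, …, v_n` and the edges `1, …, n`.
`treeDegree e n i` is the degree (out-degree plus in-degree) of `v_i` in that tree. -/
def treeDegree (e : ℕ → ℕ) (n i : ℕ) : ℕ :=
  ((Finset.Icc 1 n).filter (fun k => k = i)).card +
    ((Finset.Icc 1 n).filter (fun k => e k = i)).card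

/-- The maximal degree among the vertices `v_0, …, v_n` of the tree after `n` edges. -/
def maxDegree (e : ℕ → ℕ) (n : ℕ) : ℕ :=
  (Finset.range (n + 1)).sup (treeDegree e n)

/-- The index of the oldest vertex of maximal degree in the tree after `n` edges
(the set is never empty). -/
noncomputable def hubIndex (e : ℕ → ℕ) (n : ℕ) : ℕ :=
  sInf {i : ℕ | i ≤ n ∧ ∀ j ≤ n, treeDegree e n j ≤ treeDegree e n i}

/-- The random sequence `E 1, E 2, …` on the probability space `(Ω, μ)` is the edge sequence of the
generalized attachment tree with (positive) attachment function `f`.  Conditionally on the tree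
with vertices `v_0, …, v_n`, the new vertex `v_(n+1)` is attached to `v_i`, `i ≤ n`, with
probability `f (degree of v_i) / ∑_{j ≤ n} f (degree of v_j)`.  The past takes countably many
values `h 1, …, h n`, so the conditional probability is stated in the form
`P (past = h, E (n+1) = i) = P (past = h) * (…)`. -/
structure IsAttachmentTree {Ω : Type*} [MeasurableSpace Ω] (μ : Measure Ω) (f : ℕ → ℝ)
    (E : ℕ → Ω → ℕ) : Prop where
  measurable : ∀ k, 1 ≤ k → Measurable (E k)
  attach : ∀ (n : ℕ) (h : ℕ → ℕ) (i : ℕ), i ≤ n →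
    μ.real {ω | (∀ k ∈ Finset.Icc 1 n, E k ω = h k) ∧ E (n + 1) ω = i} =
      μ.real {ω | ∀ k ∈ Finset.Icc 1 n, E k ω = h k} *
        (f (treeDegree h n i) / ∑ j ∈ Finset.range (n + 1), f (treeDegree h n j))

/-!
The edges of the uniform recursive tree are independent, the `k`-th one ending at a uniform vertex
among `v_0, …, v_(k-1)` (`integral_mul_attach`).  Hence the number `X` of edges brought by
`v_(M+1), …, v_n` that end at a given vertex `v_i`, `i ≤ M`, has generating function
`E [t ^ X] = ∏_{M < k ≤ n} (1 + (t - 1) / k)`, which is of order `(n / M) ^ (t - 1)`.  All estimates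
come from this formula.

Upper bounds.  By Markov's inequality and a union bound, the probability that some vertex `v_i`
with `i` in a set `S` has degree at least `c log n` is, up to a logarithm, at most
`n ^ (t - 1 - c log t)` times the maximum of `(i + 1) ^ (2 - t)` over `S`
(`measureReal_exists_le_treeDegree_le`).  For `t = 2` the set does not matter and the exponent is
`1 - c log 2`: the maximal degree is at most about `log n / log 2`.  For `c = 1 / log 2` and the
vertices with `i ≤ n ^ a` or `i ≥ n ^ a`, the exponent is `t - 1 + a (2 - t) - c log t`; it vanishes
at `t = 2`, where its derivative is `1 - 1 / (2 log 2) - a`.  So some `t < 2` excludes hubs of index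
at most `n ^ a` if `a < 1 - 1 / (2 log 2)`, and some `t > 2` excludes hubs of index at least `n ^ a`
if `a > 1 - 1 / (2 log 2)` (`tendsto_measureReal_hubIndex_mem`), once it is known that the maximal
degree is not much smaller than `log n / log 2`.

Lower bound (`tendsto_measureReal_maxDegree_lt`).  Let `c < b < 1 / log 2`, and let `M` be about
`n ^ (1 - b / 2)`.  Under the law of `X` tilted by `2 ^ X`, the count `X` concentrates around
`b log n`; bounding the tilted mass elsewhere by the generating function at points close to `2` on
either side gives `P (X ≥ c log n) ≥ n ^ (b / 2 - y log 2) / 4` for `y` slightly larger than `b`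
(`div_le_rpow_mul_measureReal_add`).  The expected number of `i < M` with `X_i ≥ c log n` thus
diverges.  Since an edge ending at one vertex misses the others, these events are pairwise
negatively correlated (`integral_mul_le_mul_integral_edgesInto`), and the second moment method
(`sum_mul_measureReal_forall_notMem_le_one`) yields such an `i` with high probability.
-/

/-! ### Degrees and edge counts -/

/-- The number of edges among those brought by `v_(M+1), …, v_n` that end in `v_i`. -/
def edgesInto (e : ℕ → ℕ) (M n i : ℕ) : ℕ :=
  ((Finset.Ioc M n).filter (fun k => e k = i)).card

theorem edgesInto_self (e : ℕ → ℕ) (M i : ℕ) : edgesInto e M M i = 0 := by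
  simp [edgesInto]

theorem edgesInto_succ (e : ℕ → ℕ) {M n : ℕ} (hMn : M ≤ n) (i : ℕ) :
    edgesInto e M (n + 1) i = edgesInto e M n i + if e (n + 1) = i then 1 else 0 := by
  have h : Finset.Ioc M (n + 1) = insert (n + 1) (Finset.Ioc M n) := by
    ext k; simp only [Finset.mem_Ioc, Finset.mem_insert]; omega
  unfold edgesInto
  rw [h, Finset.filter_insert]
  split_ifs
  · rw [Finset.card_insert_of_notMem (by simp)]
  · simp

theorem edgesInto_le (e : ℕ → ℕ) (M n i : ℕ) : edgesInto e M n i ≤ n :=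
  (Finset.card_filter_le _ _).trans (by simp)

theorem edgesInto_congr {e e' : ℕ → ℕ} {n : ℕ} (h : ∀ k ∈ Set.Icc 1 n, e k = e' k) (M i : ℕ) :
    edgesInto e M n i = edgesInto e' M n i := by
  unfold edgesInto
  congr 1
  refine Finset.filter_congr fun k hk => ?_
  rw [Finset.mem_Ioc] at hk
  rw [h k ⟨by omega, hk.2⟩]

theorem edgesInto_le_treeDegree (e : ℕ → ℕ) (M n i : ℕ) :
    edgesInto e M n i ≤ treeDegree e n i := by
  refine le_add_left (Finset.card_le_card ?_)
  refine Finset.filter_subset_filter _ fun k hk => ?_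
  simp only [Finset.mem_Ioc, Finset.mem_Icc] at hk ⊢
  omega

/-- When edges point to older vertices, all edges at `v_i` other than its own edge and the edge
of `v_(i+1)` are counted by `edgesInto e (i + 1) n i`. -/
theorem treeDegree_le_edgesInto_add_two {e : ℕ → ℕ} (he : ∀ k, 1 ≤ k → e k < k) (n i : ℕ) :
    treeDegree e n i ≤ edgesInto e (i + 1) n i + 2 := by
  have h1 : ((Finset.Icc 1 n).filter (fun k => k = i)).card ≤ 1 :=
    Finset.card_le_one.2 fun a ha b hb => by
      rw [(Finset.mem_filter.1 ha).2, (Finset.mem_filter.1 hb).2]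
  have h2 : ((Finset.Icc 1 n).filter (fun k => e k = i)).card ≤ edgesInto e (i + 1) n i + 1 := by
    refine (Finset.card_le_card (t := insert (i + 1) ((Finset.Ioc (i + 1) n).filter
      (fun k => e k = i))) fun k hk => ?_).trans (Finset.card_insert_le _ _)
    simp only [Finset.mem_filter, Finset.mem_Icc, Finset.mem_insert, Finset.mem_Ioc] at hk ⊢
    have := he k hk.1.1
    omega
  unfold treeDegree
  omega

theorem exists_treeDegree_eq_maxDegree (e : ℕ → ℕ) (n : ℕ) :
    ∃ i ≤ n, treeDegree e n i = maxDegree e n := by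
  obtain ⟨i, hi, h⟩ := Finset.exists_mem_eq_sup (Finset.range (n + 1)) ⟨0, by simp⟩
    (treeDegree e n)
  exact ⟨i, Nat.lt_succ_iff.1 (Finset.mem_range.1 hi), h.symm⟩

theorem treeDegree_le_maxDegree (e : ℕ → ℕ) {n i : ℕ} (hi : i ≤ n) :
    treeDegree e n i ≤ maxDegree e n :=
  Finset.le_sup (Finset.mem_range.2 (Nat.lt_succ_of_le hi))

theorem hubIndex_spec (e : ℕ → ℕ) (n : ℕ) :
    hubIndex e n ≤ n ∧ treeDegree e n (hubIndex e n) = maxDegree e n := by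
  obtain ⟨i, hi, h⟩ := exists_treeDegree_eq_maxDegree e n
  have hmem := Nat.sInf_mem (s := {i : ℕ | i ≤ n ∧ ∀ j ≤ n, treeDegree e n j ≤ treeDegree e n i})
    ⟨i, hi, fun j hj => h ▸ treeDegree_le_maxDegree e hj⟩
  refine ⟨hmem.1, (treeDegree_le_maxDegree e hmem.1).antisymm ?_⟩
  rw [← h]
  exact hmem.2 i hi

/-! ### Independence of the edges -/

/-- Extension by zero of a history of the edges `1, …, n` to an edge sequence. -/
def extendHistory (n : ℕ) (h : Finset.Icc 1 n → ℕ) (k : ℕ) : ℕ :=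
  if hk : k ∈ Finset.Icc 1 n then h ⟨k, hk⟩ else 0

theorem DependsOn.eq_comp_extendHistory {Ω α : Type*} {n : ℕ} {g : (ℕ → ℕ) → α}
    (hg : DependsOn g (Set.Icc 1 n)) (E : ℕ → Ω → ℕ) :
    (fun ω => g fun k => E k ω) =
      (fun h => g (extendHistory n h)) ∘ fun ω (k : Finset.Icc 1 n) => E k ω := by
  funext ω
  refine hg fun k hk => ?_
  simp [extendHistory, Set.mem_Icc.1 hk]

section Attachment

variable {Ω : Type*} [MeasurableSpace Ω] {μ : Measure Ω}  {f : ℕ → ℝ} {E : ℕ → Ω → ℕ}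

theorem measurable_history (hE : IsAttachmentTree μ f E) (n : ℕ) :
    Measurable fun ω (k : Finset.Icc 1 n) => E k ω :=
  measurable_pi_lambda _ fun k => hE.measurable k (Finset.mem_Icc.1 k.2).1

theorem DependsOn.measurable_comp {α : Type*} [MeasurableSpace α] {n : ℕ} {g : (ℕ → ℕ) → α}
    (hg : DependsOn g (Set.Icc 1 n)) (hE : IsAttachmentTree μ f E) :
    Measurable fun ω => g fun k => E k ω := by
  rw [hg.eq_comp_extendHistory E]
  exact (measurable_of_countable _).comp (measurable_history hE n)

theorem measurableSet_edge_eq (hE : IsAttachmentTree μ f E) (n i : ℕ) :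
    MeasurableSet {ω | E (n + 1) ω = i} :=
  hE.measurable (n + 1) (by omega) (measurableSet_singleton i)

theorem measurable_edgesInto (hE : IsAttachmentTree μ f E) (M n i : ℕ) :
    Measurable fun ω => edgesInto (fun k => E k ω) M n i :=
  DependsOn.measurable_comp (g := fun e => edgesInto e M n i)
    (fun _ _ h => edgesInto_congr h M i) hE

variable [IsProbabilityMeasure μ]

theorem DependsOn.integrable_comp {n : ℕ} {g : (ℕ → ℕ) → ℝ}
    (hg : DependsOn g (Set.Icc 1 n)) (hE : IsAttachmentTree μ f E) (C : ℝ)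
    (hC : ∀ e, |g e| ≤ C) : Integrable (fun ω => g fun k => E k ω) μ :=
  Integrable.of_bound (hg.measurable_comp hE).aestronglyMeasurable C
    (ae_of_all _ fun _ => hC _)

/-- The law of the first `n` edges on the event that `v_(n+1)` attaches to `v_i` is
`1 / (n + 1)` times their unconditional law. -/
theorem map_history_restrict (hf : ∀ k, f k = 1) (hE : IsAttachmentTree μ f E) {n i : ℕ}
    (hi : i ≤ n) :
    (μ.restrict {ω | E (n + 1) ω = i}).map (fun ω (k : Finset.Icc 1 n) => E k ω) =
      ENNReal.ofReal (1 / (n + 1)) • μ.map (fun ω (k : Finset.Icc 1 n) => E k ω) := by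
  have hm := measurable_history hE n
  refine Measure.ext_of_singleton fun h => ?_
  have hs : (fun ω (k : Finset.Icc 1 n) => E k ω) ⁻¹' {h} =
      {ω | ∀ k ∈ Finset.Icc 1 n, E k ω = extendHistory n h k} := by
    ext ω
    simp only [Set.mem_preimage, Set.mem_singleton_iff, Set.mem_ofPred_eq, funext_iff,
      Subtype.forall]
    refine forall₂_congr fun k hk => ?_
    simp [extendHistory, Finset.mem_Icc.1 hk]
  have key := hE.attach n (extendHistory n h) i hi
  simp only [hf, Finset.sum_const, Finset.card_range, nsmul_eq_mul, mul_one, Nat.cast_add,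
    Nat.cast_one] at key
  rw [Measure.smul_apply, Measure.map_apply hm (measurableSet_singleton h),
    Measure.map_apply hm (measurableSet_singleton h),
    Measure.restrict_apply (hm (measurableSet_singleton h)), hs, smul_eq_mul,
    ← ofReal_measureReal (measure_ne_top μ _), ← ofReal_measureReal (measure_ne_top μ _),
    ← ENNReal.ofReal_mul (by positivity), mul_comm, ← key]
  rfl

/-- The event that `v_(n+1)` attaches to `v_i` has probability `1 / (n + 1)` and is independent of
the first `n` edges. -/
theorem integral_mul_attach (hf : ∀ k, f k = 1) (hE : IsAttachmentTree μ f E) {n i : ℕ}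
    (hi : i ≤ n) {g : (ℕ → ℕ) → ℝ} (hg : DependsOn g (Set.Icc 1 n)) :
    ∫ ω, g (fun k => E k ω) * (if E (n + 1) ω = i then 1 else 0) ∂μ =
      (∫ ω, g (fun k => E k ω) ∂μ) / (n + 1) := by
  have hm := measurable_history hE n
  have h1 : (fun ω => g (fun k => E k ω) * (if E (n + 1) ω = i then (1 : ℝ) else 0)) =
      Set.indicator {ω | E (n + 1) ω = i} (fun ω => g fun k => E k ω) := by
    funext ω
    simp [Set.indicator_apply]
  have hsm : StronglyMeasurable fun h : Finset.Icc 1 n → ℕ => g (extendHistory n h) :=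
    (measurable_of_countable _).stronglyMeasurable
  rw [h1, integral_indicator (measurableSet_edge_eq hE n i), hg.eq_comp_extendHistory E]
  simp only [Function.comp_def]
  rw [← integral_map hm.aemeasurable hsm.aestronglyMeasurable,
    ← integral_map (μ := μ) hm.aemeasurable hsm.aestronglyMeasurable,
    map_history_restrict hf hE hi, integral_smul_measure,
    ENNReal.toReal_ofReal (by positivity), smul_eq_mul]
  ring

theorem ae_edge_lt (hf : ∀ k, f k = 1) (hE : IsAttachmentTree μ f E) :
    ∀ᵐ ω ∂μ, ∀ k, 1 ≤ k → E k ω < k := by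
  refine ae_all_iff.2 fun k => ?_
  rcases k with _ | n
  · simp
  have h1 : ∀ i ∈ Finset.range (n + 1), μ.real {ω | E (n + 1) ω = i} = 1 / (n + 1) := by
    intro i hi
    have := integral_mul_attach (g := fun _ => 1) hf hE
      (Nat.lt_succ_iff.1 (Finset.mem_range.1 hi)) (fun _ _ _ => rfl)
    simp only [one_mul, integral_const, probReal_univ, smul_eq_mul, mul_one] at this
    rw [← this, ← integral_indicator_one (measurableSet_edge_eq hE n i)]
    simp [Set.indicator_apply]
  have h2 : {ω | E (n + 1) ω < n + 1} = ⋃ i ∈ Finset.range (n + 1), {ω | E (n + 1) ω = i} := by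
    ext ω; simp
  have h3 : μ.real {ω | E (n + 1) ω < n + 1} = 1 := by
    rw [h2, measureReal_biUnion_finset _ fun i _ => measurableSet_edge_eq hE n i,
      Finset.sum_congr rfl h1]
    · simp; field_simp
    · intro i _ j _ hij
      refine Set.disjoint_left.2 fun ω h1 h2 => hij (h1.symm.trans h2)
  have h4 : MeasurableSet {ω | E (n + 1) ω < n + 1} :=
    hE.measurable (n + 1) (by omega) (measurableSet_Iio (a := n + 1))
  have h5 : ∀ᵐ ω ∂μ, E (n + 1) ω < n + 1 := by
    refine (mem_ae_iff_prob_eq_one h4).2 ?_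
    rw [← ofReal_measureReal (measure_ne_top μ _), h3, ENNReal.ofReal_one]
  filter_upwards [h5] with ω h _ using h

/-! ### The law of the edge counts -/

theorem dependsOn_edgesInto₂ (M n i j : ℕ) (φ : ℕ → ℕ → ℝ) :
    DependsOn (fun e => φ (edgesInto e M n i) (edgesInto e M n j)) (Set.Icc 1 n) := by
  intro e e' h
  simp only [edgesInto_congr h]

theorem integrable_edgesInto₂ (hE : IsAttachmentTree μ f E) (M n i j : ℕ) (φ : ℕ → ℕ → ℝ) :
    Integrable (fun ω => φ (edgesInto (fun k => E k ω) M n i)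
      (edgesInto (fun k => E k ω) M n j)) μ := by
  refine (dependsOn_edgesInto₂ M n i j φ).integrable_comp hE
    (∑ x ∈ Finset.range (n + 1), ∑ y ∈ Finset.range (n + 1), |φ x y|) fun e => ?_
  have h (i : ℕ) : edgesInto e M n i ∈ Finset.range (n + 1) :=
    Finset.mem_range.2 (Nat.lt_succ_of_le (edgesInto_le e M n i))
  exact (Finset.single_le_sum (f := fun y => |φ (edgesInto e M n i) y|)
    (fun _ _ => abs_nonneg _) (h j)).trans (Finset.single_le_sum
      (f := fun x => ∑ y ∈ Finset.range (n + 1), |φ x y|)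
      (fun _ _ => Finset.sum_nonneg fun _ _ => abs_nonneg _) (h i))

theorem integrable_edgesInto (hE : IsAttachmentTree μ f E) (M n i : ℕ) (φ : ℕ → ℝ) :
    Integrable (fun ω => φ (edgesInto (fun k => E k ω) M n i)) μ :=
  integrable_edgesInto₂ hE M n i i fun x _ => φ x

theorem integrable_edgesInto₂_mul_attach (hE : IsAttachmentTree μ f E) (M n i j l : ℕ)
    (φ : ℕ → ℕ → ℝ) :
    Integrable (fun ω => φ (edgesInto (fun k => E k ω) M n i) (edgesInto (fun k => E k ω) M n j) *
        (if E (n + 1) ω = l then (1 : ℝ) else 0)) μ := by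
  refine (integrable_edgesInto₂ hE M n i j φ).mul_bdd (c := 1) ?_
    (ae_of_all _ fun ω => by split_ifs <;> simp)
  exact (Measurable.ite (measurableSet_edge_eq hE n l) measurable_const
    measurable_const).aestronglyMeasurable

/-- One-step evolution of the joint law of the numbers of edges into two vertices. -/
theorem integral_edgesInto₂_succ (hf : ∀ k, f k = 1) (hE : IsAttachmentTree μ f E) {M n i j : ℕ}
    (hij : i ≠ j) (hi : i ≤ M) (hj : j ≤ M) (hn : M ≤ n) (φ : ℕ → ℕ → ℝ) :
    ∫ ω, φ (edgesInto (fun k => E k ω) M (n + 1) i) (edgesInto (fun k => E k ω) M (n + 1) j) ∂μ =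
      (1 - 2 / (n + 1)) *
          ∫ ω, φ (edgesInto (fun k => E k ω) M n i) (edgesInto (fun k => E k ω) M n j) ∂μ +
        (∫ ω, φ (edgesInto (fun k => E k ω) M n i + 1) (edgesInto (fun k => E k ω) M n j) ∂μ) /
          (n + 1) +
        (∫ ω, φ (edgesInto (fun k => E k ω) M n i) (edgesInto (fun k => E k ω) M n j + 1) ∂μ) /
          (n + 1) := by
  have key (ω : Ω) :
      φ (edgesInto (fun k => E k ω) M (n + 1) i) (edgesInto (fun k => E k ω) M (n + 1) j) =
      φ (edgesInto (fun k => E k ω) M n i) (edgesInto (fun k => E k ω) M n j) +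
      (φ (edgesInto (fun k => E k ω) M n i + 1) (edgesInto (fun k => E k ω) M n j) -
        φ (edgesInto (fun k => E k ω) M n i) (edgesInto (fun k => E k ω) M n j)) *
          (if E (n + 1) ω = i then 1 else 0) +
      (φ (edgesInto (fun k => E k ω) M n i) (edgesInto (fun k => E k ω) M n j + 1) -
        φ (edgesInto (fun k => E k ω) M n i) (edgesInto (fun k => E k ω) M n j)) *
          (if E (n + 1) ω = j then 1 else 0) := by
    rw [edgesInto_succ _ hn, edgesInto_succ _ hn]
    by_cases h1 : E (n + 1) ω = i
    · have h2 : E (n + 1) ω ≠ j := fun h => hij (h1.symm.trans h)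
      simp only [if_pos h1, if_neg h2, add_zero]
      ring
    · by_cases h2 : E (n + 1) ω = j
      · simp only [if_neg h1, if_pos h2, add_zero]
        ring
      · simp only [if_neg h1, if_neg h2, add_zero]
        ring
  have I0 := integrable_edgesInto₂ hE M n i j φ
  have I1 := integrable_edgesInto₂ hE M n i j fun x y => φ (x + 1) y
  have I2 := integrable_edgesInto₂ hE M n i j fun x y => φ x (y + 1)
  have J1 := integrable_edgesInto₂_mul_attach hE M n i j i fun x y => φ (x + 1) y - φ x y
  have J2 := integrable_edgesInto₂_mul_attach hE M n i j j fun x y => φ x (y + 1) - φ x y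
  have A1 := integral_mul_attach hf hE (hi.trans hn)
    (dependsOn_edgesInto₂ M n i j fun x y => φ (x + 1) y - φ x y)
  have A2 := integral_mul_attach hf hE (hj.trans hn)
    (dependsOn_edgesInto₂ M n i j fun x y => φ x (y + 1) - φ x y)
  simp only [key]
  rw [integral_add ?_ J2, integral_add I0 J1, A1, A2, integral_sub I1 I0, integral_sub I2 I0]
  · ring
  · exact I0.add J1

/-- One-step evolution of the law of the number of edges into a vertex. -/
theorem integral_edgesInto_succ (hf : ∀ k, f k = 1) (hE : IsAttachmentTree μ f E) {M n i : ℕ}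
    (hi : i ≤ M) (hn : M ≤ n) (φ : ℕ → ℝ) :
    ∫ ω, φ (edgesInto (fun k => E k ω) M (n + 1) i) ∂μ =
      (1 - 1 / (n + 1)) * ∫ ω, φ (edgesInto (fun k => E k ω) M n i) ∂μ +
        (∫ ω, φ (edgesInto (fun k => E k ω) M n i + 1) ∂μ) / (n + 1) := by
  have key (ω : Ω) : φ (edgesInto (fun k => E k ω) M (n + 1) i) =
      φ (edgesInto (fun k => E k ω) M n i) + (φ (edgesInto (fun k => E k ω) M n i + 1) -
        φ (edgesInto (fun k => E k ω) M n i)) * (if E (n + 1) ω = i then 1 else 0) := by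
    rw [edgesInto_succ _ hn]
    split_ifs <;> simp
  have I0 := integrable_edgesInto hE M n i φ
  have I1 := integrable_edgesInto hE M n i fun x => φ (x + 1)
  have J1 := integrable_edgesInto₂_mul_attach hE M n i i i fun x _ => φ (x + 1) - φ x
  have A1 := integral_mul_attach hf hE (hi.trans hn)
    (dependsOn_edgesInto₂ M n i i fun x _ => φ (x + 1) - φ x)
  simp only [key]
  rw [integral_add I0 J1, A1, integral_sub I1 I0]
  ring

/-- The probability generating function of the number of edges into a vertex. -/
theorem integral_pow_edgesInto (hf : ∀ k, f k = 1) (hE : IsAttachmentTree μ f E) {M i : ℕ}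
    (hi : i ≤ M) (t : ℝ) {n : ℕ} (hn : M ≤ n) :
    ∫ ω, t ^ edgesInto (fun k => E k ω) M n i ∂μ =
      ∏ k ∈ Finset.Ioc M n, (1 + (t - 1) / (k : ℝ)) := by
  induction n, hn using Nat.le_induction with
  | base => simp [edgesInto_self]
  | succ n hn ih =>
    rw [integral_edgesInto_succ hf hE hi hn (fun x => t ^ x)]
    simp only [pow_succ, integral_mul_const]
    rw [ih, ← Finset.insert_Ioc_right_eq_Ioc_add_one hn, Finset.prod_insert (by simp)]
    push_cast
    ring

/-- The numbers of edges into two different vertices are negatively correlated: an edge that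
reaches one of them misses the other. -/
theorem integral_mul_le_mul_integral_edgesInto (hf : ∀ k, f k = 1) (hE : IsAttachmentTree μ f E)
    {M n i j : ℕ} (hij : i ≠ j) (hi : i ≤ M) (hj : j ≤ M) (hn : M ≤ n) {φ ψ : ℕ → ℝ}
    (hφ : Monotone φ) (hψ : Monotone ψ) :
    ∫ ω, φ (edgesInto (fun k => E k ω) M n i) * ψ (edgesInto (fun k => E k ω) M n j) ∂μ ≤
      (∫ ω, φ (edgesInto (fun k => E k ω) M n i) ∂μ) *
        ∫ ω, ψ (edgesInto (fun k => E k ω) M n j) ∂μ := by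
  induction n, hn using Nat.le_induction generalizing φ ψ with
  | base => simp [edgesInto_self]
  | succ n hn ih =>
    have hφ' : Monotone fun x => φ (x + 1) := fun x y h => hφ (Nat.succ_le_succ h)
    have hψ' : Monotone fun x => ψ (x + 1) := fun x y h => hψ (Nat.succ_le_succ h)
    rw [integral_edgesInto₂_succ hf hE hij hi hj hn (fun x y => φ x * ψ y),
      integral_edgesInto_succ hf hE hi hn, integral_edgesInto_succ hf hE hj hn]
    have a0 := ih hφ hψ
    have a1 := ih hφ' hψ
    have a2 := ih hφ hψ'
    have b1 := integral_mono (integrable_edgesInto hE M n i φ)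
      (integrable_edgesInto hE M n i fun x => φ (x + 1)) fun ω => hφ (Nat.le_succ _)
    have b2 := integral_mono (integrable_edgesInto hE M n j ψ)
      (integrable_edgesInto hE M n j fun x => ψ (x + 1)) fun ω => hψ (Nat.le_succ _)
    have hp : (0 : ℝ) ≤ 1 - 2 / (n + 1) := by
      have : (1 : ℝ) ≤ n := by exact_mod_cast (by omega : 1 ≤ n)
      rw [sub_nonneg, div_le_one (by positivity)]
      linarith
    obtain ⟨p, hq, e⟩ : ∃ p : ℝ, 0 < p ∧ ∀ x : ℝ, x / (n + 1) = x * p :=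
      ⟨((n : ℝ) + 1)⁻¹, by positivity, fun x => div_eq_mul_inv _ _⟩
    simp only [e] at hp ⊢
    refine (add_le_add (add_le_add (mul_le_mul_of_nonneg_left a0 hp)
      (mul_le_mul_of_nonneg_right a1 hq.le)) (mul_le_mul_of_nonneg_right a2 hq.le)).trans ?_
    have := mul_nonneg (mul_nonneg hq.le hq.le) (mul_nonneg (sub_nonneg.2 b1) (sub_nonneg.2 b2))
    simp only [one_mul] at *
    nlinarith [this]

end Attachment

/-! ### The second moment method -/

/-- Chebyshev's inequality for the number of events that occur, under pairwise negative
correlation. -/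
theorem sum_mul_measureReal_forall_notMem_le_one {Ω ι : Type*} [MeasurableSpace Ω] {μ : Measure Ω}
    [IsProbabilityMeasure μ] (s : Finset ι) {A : ι → Set Ω}
    (hA : ∀ i ∈ s, MeasurableSet (A i))
    (hneg : ∀ i ∈ s, ∀ j ∈ s, i ≠ j → μ.real (A i ∩ A j) ≤ μ.real (A i) * μ.real (A j)) :
    (∑ i ∈ s, μ.real (A i)) * μ.real {ω | ∀ i ∈ s, ω ∉ A i} ≤ 1 := by
  classical
  set l := ∑ i ∈ s, μ.real (A i) with hl
  have hl0 : 0 ≤ l := Finset.sum_nonneg fun _ _ => measureReal_nonneg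
  rcases hl0.eq_or_lt with h0 | h0
  · simp [← h0]
  have hint : ∀ i ∈ s, Integrable ((A i).indicator (1 : Ω → ℝ)) μ := fun i hi =>
    (integrable_const (1 : ℝ)).indicator (hA i hi)
  have hint2 : ∀ i ∈ s, ∀ j ∈ s, Integrable ((A i ∩ A j).indicator (1 : Ω → ℝ)) μ :=
    fun i hi j hj => (integrable_const (1 : ℝ)).indicator ((hA i hi).inter (hA j hj))
  have hN : ∀ ω, (∑ i ∈ s, (A i).indicator (1 : Ω → ℝ) ω - l) ^ 2 =
      (∑ i ∈ s, ∑ j ∈ s, (A i ∩ A j).indicator (1 : Ω → ℝ) ω) -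
        2 * l * (∑ i ∈ s, (A i).indicator (1 : Ω → ℝ) ω) + l ^ 2 := by
    intro ω
    simp only [Set.inter_indicator_one, Pi.mul_apply]
    rw [← Finset.sum_mul_sum]
    ring
  have hi1 : Integrable (fun ω => ∑ i ∈ s, (A i).indicator (1 : Ω → ℝ) ω) μ :=
    integrable_finsetSum _ hint
  have hi2 : Integrable (fun ω => ∑ i ∈ s, ∑ j ∈ s, (A i ∩ A j).indicator (1 : Ω → ℝ) ω) μ :=
    integrable_finsetSum _ fun i hi => integrable_finsetSum _ (hint2 i hi)
  have hi3 : Integrable (fun ω => (∑ i ∈ s, (A i).indicator (1 : Ω → ℝ) ω - l) ^ 2) μ := by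
    simp only [hN]
    exact (hi2.sub (hi1.const_mul _)).add (integrable_const _)
  have hvar : ∫ ω, (∑ i ∈ s, (A i).indicator (1 : Ω → ℝ) ω - l) ^ 2 ∂μ ≤ l := by
    simp only [hN]
    rw [integral_add ?_ (integrable_const _), integral_sub hi2 (hi1.const_mul _),
      integral_const_mul, integral_finsetSum _ hint,
      integral_finsetSum _ fun i hi => integrable_finsetSum _ (hint2 i hi)]
    · have h1 : ∑ i ∈ s, ∫ ω, (A i).indicator (1 : Ω → ℝ) ω ∂μ = l :=
        Finset.sum_congr rfl fun i hi => integral_indicator_one (hA i hi)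
      have h2 : ∑ i ∈ s, ∫ ω, ∑ j ∈ s, (A i ∩ A j).indicator (1 : Ω → ℝ) ω ∂μ ≤ l + l * l := by
        rw [hl, Finset.sum_mul, ← Finset.sum_add_distrib]
        refine Finset.sum_le_sum fun i hi => ?_
        rw [integral_finsetSum _ (hint2 i hi), ← Finset.add_sum_erase _ _ hi]
        refine add_le_add ?_ ?_
        · rw [Set.inter_self, integral_indicator_one (hA i hi)]
        · rw [Finset.mul_sum]
          refine (Finset.sum_le_sum fun j hj => ?_).trans
            (Finset.sum_le_sum_of_subset_of_nonneg (Finset.erase_subset i s)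
              fun j _ _ => mul_nonneg measureReal_nonneg measureReal_nonneg)
          have hj' := Finset.mem_erase.1 hj
          rw [integral_indicator_one ((hA i hi).inter (hA j hj'.2))]
          exact hneg i hi j hj'.2 hj'.1.symm
      rw [h1, integral_const, probReal_univ, one_smul]
      nlinarith
    · exact hi2.sub (hi1.const_mul _)
  have hmarkov := mul_meas_ge_le_integral_of_nonneg
    (ae_of_all μ fun ω => sq_nonneg (∑ i ∈ s, (A i).indicator (1 : Ω → ℝ) ω - l)) hi3 (l ^ 2)
  have hsub : μ.real {ω | ∀ i ∈ s, ω ∉ A i} ≤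
      μ.real {ω | l ^ 2 ≤ (∑ i ∈ s, (A i).indicator (1 : Ω → ℝ) ω - l) ^ 2} := by
    refine measureReal_mono fun ω hω => ?_
    have : ∑ i ∈ s, (A i).indicator (1 : Ω → ℝ) ω = 0 :=
      Finset.sum_eq_zero fun i hi => Set.indicator_of_notMem (hω i hi) _
    simp [this]
  have h3 : l * (l * μ.real {ω | ∀ i ∈ s, ω ∉ A i}) ≤ l * 1 := by
    nlinarith [mul_le_mul_of_nonneg_left hsub (sq_nonneg l)]
  exact le_of_mul_le_mul_left h3 h0

/-! ### Products of the form `∏ (1 + s / k)` -/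

theorem prod_one_add_div_le {s : ℝ} (hs : 0 ≤ s) {M n : ℕ} (hM : 1 ≤ M) (hn : M ≤ n) :
    ∏ k ∈ Finset.Ioc M n, (1 + s / (k : ℝ)) ≤ ((n : ℝ) / M) ^ s := by
  have hM0 : (0 : ℝ) < M := by exact_mod_cast hM
  induction n, hn using Nat.le_induction with
  | base => simp [hM0.ne']
  | succ n hn ih =>
    have hn0 : (0 : ℝ) < n := by exact_mod_cast hM.trans hn
    rw [← Finset.insert_Ioc_right_eq_Ioc_add_one hn, Finset.prod_insert (by simp)]
    have h1 : ((n + 1 : ℕ) : ℝ) / M = ((n + 1) / n) * (n / M) := by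
      push_cast; field_simp
    rw [h1, Real.mul_rpow (by positivity) (by positivity)]
    refine mul_le_mul ?_ ih (Finset.prod_nonneg fun k _ => by positivity) (by positivity)
    -- `log (1 + 1 / n) ≥ 1 / (n + 1)`
    have h2 : 1 - ((n + 1) / n : ℝ)⁻¹ ≤ Real.log ((n + 1) / n) :=
      Real.one_sub_inv_le_log_of_pos (by positivity)
    have h3 : 1 - ((n + 1) / n : ℝ)⁻¹ = 1 / (n + 1) := by field_simp; ring
    rw [h3] at h2
    rw [Real.rpow_def_of_pos (by positivity)]
    have h4 := mul_le_mul_of_nonneg_right h2 hs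
    have h5 : s / ((n + 1 : ℕ) : ℝ) = 1 / ((n : ℝ) + 1) * s := by push_cast; ring
    linarith [Real.add_one_le_exp (Real.log ((n + 1) / n : ℝ) * s)]

theorem prod_one_add_one_div {M n : ℕ} (hn : M ≤ n) :
    ∏ k ∈ Finset.Ioc M n, (1 + 1 / (k : ℝ)) = ((n : ℝ) + 1) / (M + 1) := by
  induction n, hn using Nat.le_induction with
  | base => simp; field_simp
  | succ n hn ih =>
    rw [← Finset.insert_Ioc_right_eq_Ioc_add_one hn, Finset.prod_insert (by simp), ih]
    push_cast
    field_simp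

/-! ### Tail bounds -/

section Tails

variable {Ω : Type*} [MeasurableSpace Ω] {μ : Measure Ω} [IsProbabilityMeasure μ]
  {f : ℕ → ℝ} {E : ℕ → Ω → ℕ}

theorem integral_pow_edgesInto_le (hf : ∀ k, f k = 1) (hE : IsAttachmentTree μ f E)
    {M n i : ℕ} (hM : 1 ≤ M) (hi : i ≤ M) (hn : M ≤ n) {t : ℝ} (ht : 1 ≤ t) :
    ∫ ω, t ^ edgesInto (fun k => E k ω) M n i ∂μ ≤ ((n : ℝ) / M) ^ (t - 1) := by
  rw [integral_pow_edgesInto hf hE hi t hn]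
  exact prod_one_add_div_le (by linarith) hM hn

/-- Chernoff bound for the number of edges into `v_i` that arrive after `v_(i+1)`. -/
theorem measureReal_le_edgesInto_le (hf : ∀ k, f k = 1) (hE : IsAttachmentTree μ f E)
    {n i : ℕ} (hi : i ≤ n) {t : ℝ} (ht : 1 < t) (x : ℝ) :
    μ.real {ω | x ≤ edgesInto (fun k => E k ω) (i + 1) n i} ≤
      t ^ (-x) * (((n : ℝ) + 1) / (i + 1)) ^ (t - 1) := by
  have ht0 : 0 < t := by linarith
  have h1 : ∫ ω, t ^ edgesInto (fun k => E k ω) (i + 1) n i ∂μ ≤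
      (((n : ℝ) + 1) / (i + 1)) ^ (t - 1) := by
    rcases hi.lt_or_eq with h | rfl
    · refine (integral_pow_edgesInto_le hf hE (by omega) (Nat.le_succ i) h ht.le).trans ?_
      push_cast
      gcongr; linarith
    · have : ∀ ω, edgesInto (fun k => E k ω) (i + 1) i i = 0 := fun ω => by simp [edgesInto]
      simp only [this, pow_zero, integral_const, probReal_univ, one_smul]
      rw [div_self (by positivity), Real.one_rpow]
  have h2 := mul_meas_ge_le_integral_of_nonneg
    (ae_of_all μ fun ω => by positivity)
    (integrable_edgesInto hE (i + 1) n i fun k => t ^ k) (t ^ x)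
  have h3 : μ.real {ω | x ≤ edgesInto (fun k => E k ω) (i + 1) n i} ≤
      μ.real {ω | t ^ x ≤ t ^ edgesInto (fun k => E k ω) (i + 1) n i} := by
    refine measureReal_mono fun ω hω => ?_
    show t ^ x ≤ t ^ edgesInto (fun k => E k ω) (i + 1) n i
    rw [← Real.rpow_natCast]
    exact Real.rpow_le_rpow_of_exponent_le ht.le hω
  have hx : 0 < t ^ x := Real.rpow_pos_of_pos ht0 x
  rw [Real.rpow_neg ht0.le, ← div_eq_inv_mul, le_div_iff₀' hx]
  exact (mul_le_mul_of_nonneg_left h3 hx.le).trans (h2.trans h1)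

/-- Union bound over a set `S` of vertices.  The factor `R` bounds the ratio of
`(i + 1) ^ (1 - t)` to the harmonic weight `(i + 1)⁻¹` on `S`. -/
theorem measureReal_exists_le_treeDegree_le (hf : ∀ k, f k = 1) (hE : IsAttachmentTree μ f E)
    {n : ℕ} {t : ℝ} (ht : 1 < t) (x : ℝ) {S : Set ℕ} {R : ℝ}
    (hS : ∀ i ∈ S, i ≤ n → ((i : ℝ) + 1) ^ (2 - t) ≤ R) (hR : 0 ≤ R) :
    μ.real {ω | ∃ i ∈ S, i ≤ n ∧ x ≤ treeDegree (fun k => E k ω) n i} ≤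
      t ^ (2 - x) * ((n : ℝ) + 1) ^ (t - 1) * R * (1 + Real.log (n + 1)) := by
  classical
  have ht0 : 0 < t := by linarith
  have h1 : μ.real {ω | ∃ i ∈ S, i ≤ n ∧ x ≤ treeDegree (fun k => E k ω) n i} ≤
      μ.real (⋃ i ∈ (Finset.range (n + 1)).filter (· ∈ S),
        {ω | x - 2 ≤ edgesInto (fun k => E k ω) (i + 1) n i}) := by
    refine ENNReal.toReal_mono (measure_ne_top _ _) (measure_mono_ae ?_)
    filter_upwards [ae_edge_lt hf hE] with ω hω
    rintro ⟨i, hiS, hin, hx⟩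
    refine Set.mem_biUnion (Finset.mem_coe.2 (Finset.mem_filter.2
      ⟨Finset.mem_range.2 (by omega), hiS⟩)) ?_
    have : (treeDegree (fun k => E k ω) n i : ℝ) ≤ edgesInto (fun k => E k ω) (i + 1) n i + 2 := by
      exact_mod_cast treeDegree_le_edgesInto_add_two hω n i
    show x - 2 ≤ _
    linarith
  refine h1.trans ((measureReal_biUnion_finset_le _ _).trans ?_)
  have h2 : ∀ i ∈ (Finset.range (n + 1)).filter (· ∈ S),
      μ.real {ω | x - 2 ≤ edgesInto (fun k => E k ω) (i + 1) n i} ≤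
        t ^ (2 - x) * ((n : ℝ) + 1) ^ (t - 1) * R * ((i : ℝ) + 1)⁻¹ := by
    intro i hi
    rw [Finset.mem_filter, Finset.mem_range] at hi
    refine (measureReal_le_edgesInto_le hf hE (by omega) ht _).trans ?_
    have h3 := hS i hi.2 (by omega)
    have hi0 : (0 : ℝ) < (i : ℝ) + 1 := by positivity
    have h4 : (((n : ℝ) + 1) / (i + 1)) ^ (t - 1) =
        ((n : ℝ) + 1) ^ (t - 1) * (((i : ℝ) + 1) ^ (2 - t) * ((i : ℝ) + 1)⁻¹) := by
      rw [Real.div_rpow (by positivity) hi0.le, div_eq_mul_inv, ← Real.rpow_neg hi0.le,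
        ← Real.rpow_neg_one, ← Real.rpow_add hi0]
      congr 2
      ring
    rw [h4, neg_sub, ← mul_assoc, ← mul_assoc]
    gcongr
  refine (Finset.sum_le_sum h2).trans ?_
  rw [← Finset.mul_sum]
  refine mul_le_mul_of_nonneg_left ?_ (by positivity)
  refine (Finset.sum_le_sum_of_subset_of_nonneg (Finset.filter_subset _ _)
    fun i _ _ => by positivity).trans ?_
  have := harmonic_le_one_add_log (n + 1)
  simpa [harmonic] using this

/-- The lower bound on a tail obtained by tilting with the factor `2`: the generating function at
`2` is carried by the values in `[x, y]`, up to the two error terms. -/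
theorem div_le_rpow_mul_measureReal_add (hf : ∀ k, f k = 1) (hE : IsAttachmentTree μ f E)
    {M n i : ℕ} (hM : 1 ≤ M) (hi : i ≤ M) (hn : M ≤ n) {x y t u : ℝ}
    (ht : 1 < t) (ht2 : t < 2) (hu : 2 < u) :
    ((n : ℝ) + 1) / (M + 1) ≤
      2 ^ y * μ.real {ω | x ≤ edgesInto (fun k => E k ω) M n i} +
        (2 / t) ^ x * ((n : ℝ) / M) ^ (t - 1) + (2 / u) ^ y * ((n : ℝ) / M) ^ (u - 1) := by
  have ht0 : 0 < t := by linarith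
  have hu0 : 0 < u := by linarith
  have h2 := integral_pow_edgesInto hf hE hi 2 hn
  norm_num only at h2
  rw [prod_one_add_one_div hn] at h2
  rw [← h2]
  have hms : MeasurableSet {ω | x ≤ edgesInto (fun k => E k ω) M n i} :=
    measurable_edgesInto hE M n i (MeasurableSet.of_discrete (s := {k : ℕ | x ≤ k}))
  have I0 : Integrable ({ω | x ≤ edgesInto (fun k => E k ω) M n i}.indicator (1 : Ω → ℝ)) μ :=
    (integrable_const (1 : ℝ)).indicator hms
  have It := integrable_edgesInto hE M n i fun k => t ^ k
  have Iu := integrable_edgesInto hE M n i fun k => u ^ k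
  have hpt : ∀ ω, (2 : ℝ) ^ edgesInto (fun k => E k ω) M n i ≤
      2 ^ y * {ω | x ≤ edgesInto (fun k => E k ω) M n i}.indicator (1 : Ω → ℝ) ω +
        (2 / t) ^ x * t ^ edgesInto (fun k => E k ω) M n i +
        (2 / u) ^ y * u ^ edgesInto (fun k => E k ω) M n i := by
    intro ω
    have hi0 : 0 ≤ 2 ^ y * {ω | x ≤ edgesInto (fun k => E k ω) M n i}.indicator (1 : Ω → ℝ) ω :=
      mul_nonneg (by positivity) (Set.indicator_nonneg (fun _ _ => zero_le_one) _)
    set Y := edgesInto (fun k => E k ω) M n i with hY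
    have e1 : (0 : ℝ) ≤ (2 / t) ^ x * t ^ Y := by positivity
    have e2 : (0 : ℝ) ≤ (2 / u) ^ y * u ^ Y := by positivity
    have split : ∀ v : ℝ, 0 < v → (2 : ℝ) ^ Y = (2 / v) ^ (Y : ℝ) * v ^ Y := by
      intro v hv
      rw [Real.rpow_natCast, ← mul_pow, div_mul_cancel₀ _ hv.ne']
    rcases lt_or_ge (Y : ℝ) x with h | h
    · have : (2 / t) ^ (Y : ℝ) ≤ (2 / t) ^ x :=
        Real.rpow_le_rpow_of_exponent_le ((one_le_div ht0).2 ht2.le) h.le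
      have := mul_le_mul_of_nonneg_right this (pow_nonneg ht0.le Y)
      rw [← split t ht0] at this
      linarith
    rcases le_or_gt (Y : ℝ) y with h' | h'
    · have h3 : {ω | x ≤ edgesInto (fun k => E k ω) M n i}.indicator (1 : Ω → ℝ) ω = 1 :=
        Set.indicator_of_mem (show ω ∈ {ω | x ≤ edgesInto (fun k => E k ω) M n i} from h) _
      rw [h3, mul_one]
      have : (2 : ℝ) ^ (Y : ℝ) ≤ 2 ^ y := Real.rpow_le_rpow_of_exponent_le one_le_two h'
      rw [Real.rpow_natCast] at this
      linarith
    · have : (2 / u) ^ (Y : ℝ) ≤ (2 / u) ^ y :=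
        Real.rpow_le_rpow_of_exponent_ge (by positivity) ((div_le_one hu0).2 hu.le) h'.le
      have := mul_le_mul_of_nonneg_right this (pow_nonneg hu0.le Y)
      rw [← split u hu0] at this
      linarith
  have I1 := (I0.const_mul ((2 : ℝ) ^ y)).add (It.const_mul ((2 / t) ^ x))
  refine (integral_mono (integrable_edgesInto hE M n i fun k => (2 : ℝ) ^ k)
    (I1.add (Iu.const_mul ((2 / u) ^ y))) hpt).trans ?_
  refine (integral_add I1 (Iu.const_mul ((2 / u) ^ y))).trans_le ?_
  refine (congrArg (· + _) (integral_add (I0.const_mul ((2 : ℝ) ^ y))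
    (It.const_mul ((2 / t) ^ x)))).trans_le ?_
  rw [integral_const_mul, integral_const_mul, integral_const_mul, integral_indicator_one hms]
  have b1 := integral_pow_edgesInto_le hf hE hM hi hn ht.le
  have b2 := integral_pow_edgesInto_le hf hE hM hi hn (one_le_two.trans hu.le)
  gcongr

/-- Second moment bound for the event that no vertex among `v_0, …, v_(M-1)` has large degree. -/
theorem mul_measureReal_forall_treeDegree_lt_le_one (hf : ∀ k, f k = 1)
    (hE : IsAttachmentTree μ f E) {M n : ℕ} (hn : M ≤ n) {x p : ℝ}
    (h : ∀ i < M, p ≤ μ.real {ω | x ≤ edgesInto (fun k => E k ω) M n i}) :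
    M * p * μ.real {ω | ∀ i < M, (treeDegree (fun k => E k ω) n i : ℝ) < x} ≤ 1 := by
  set φ : ℕ → ℝ := {k : ℕ | x ≤ k}.indicator 1 with hφ
  have hms : ∀ i, MeasurableSet {ω | x ≤ edgesInto (fun k => E k ω) M n i} := fun i =>
    measurable_edgesInto hE M n i (MeasurableSet.of_discrete (s := {k : ℕ | x ≤ k}))
  have hmono : Monotone φ := by
    intro a b hab
    by_cases ha : x ≤ a
    · have hb : x ≤ b := ha.trans (by exact_mod_cast hab)
      simp [φ, ha, hb]
    · simp only [φ, Set.indicator_apply, Set.mem_ofPred_eq, ha, if_false]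
      split_ifs <;> simp
  have hφi : ∀ i ω, φ (edgesInto (fun k => E k ω) M n i) =
      {ω | x ≤ edgesInto (fun k => E k ω) M n i}.indicator (1 : Ω → ℝ) ω := by
    intro i ω
    simp [φ, Set.indicator_apply]
  have key := sum_mul_measureReal_forall_notMem_le_one (μ := μ) (Finset.range M)
    (A := fun i => {ω | x ≤ edgesInto (fun k => E k ω) M n i}) (fun i _ => hms i) (by
      intro i hi j hj hij
      rw [Finset.mem_range] at hi hj
      have := integral_mul_le_mul_integral_edgesInto hf hE hij hi.le hj.le hn hmono hmono
      simp only [hφi, integral_indicator_one (hms _)] at this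
      rw [← integral_indicator_one ((hms i).inter (hms j)), Set.inter_indicator_one]
      exact this)
  refine le_trans (mul_le_mul ?_ ?_ measureReal_nonneg
    (Finset.sum_nonneg fun _ _ => measureReal_nonneg)) key
  · have := Finset.card_nsmul_le_sum (Finset.range M)
      (fun i => μ.real {ω | x ≤ edgesInto (fun k => E k ω) M n i}) p
      fun i hi => h i (Finset.mem_range.1 hi)
    simpa using this
  · refine measureReal_mono fun ω hω i hi hx => ?_
    have h1 := hω i (Finset.mem_range.1 hi)
    have h2 : (edgesInto (fun k => E k ω) M n i : ℝ) ≤ treeDegree (fun k => E k ω) n i := by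
      exact_mod_cast edgesInto_le_treeDegree _ M n i
    exact absurd (show x ≤ edgesInto (fun k => E k ω) M n i from hx) (by linarith)

end Tails

/-! ### Choice of the tilting parameter -/

/-- The function `t ↦ (t - 2) * p - 2 * q * log (t / 2)` vanishes at `2` with derivative `p - q`,
so it is negative just below `2` if `q < p`. -/
theorem exists_tilt_lt_two {p q : ℝ} (hq : 0 < q) (hqp : q < p) :
    ∃ t : ℝ, 1 < t ∧ t < 2 ∧ (t - 2) * p - 2 * q * Real.log (t / 2) < 0 := by
  have hp : 0 < p := hq.trans hqp
  obtain ⟨t, h1, h2⟩ := exists_between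
    (max_lt one_lt_two ((div_lt_iff₀ hp).2 (by linarith)) : max 1 (2 * q / p) < 2)
  have ht : 1 < t := (le_max_left _ _).trans_lt h1
  have ht' : 2 * q / p < t := (le_max_right _ _).trans_lt h1
  rw [div_lt_iff₀ hp] at ht'
  have hlog := Real.one_sub_inv_le_log_of_pos (by linarith : 0 < t / 2)
  refine ⟨t, ht, h2, ?_⟩
  have h3 : 2 * q * (1 - (t / 2)⁻¹) ≤ 2 * q * Real.log (t / 2) :=
    mul_le_mul_of_nonneg_left hlog (by linarith)
  have h4 : (t - 2) * p - 2 * q * (1 - (t / 2)⁻¹) = (t - 2) * (t * p - 2 * q) / t := by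
    have : t ≠ 0 := by linarith
    field_simp
  have h5 : (t - 2) * (t * p - 2 * q) / t < 0 :=
    div_neg_of_neg_of_pos (mul_neg_of_neg_of_pos (by linarith) (by linarith)) (by linarith)
  linarith

/-- The counterpart of `exists_tilt_lt_two` just above `2`. -/
theorem exists_two_lt_tilt {p q : ℝ} (hq : 0 < q) (hpq : p < q) :
    ∃ t : ℝ, 2 < t ∧ (t - 2) * p - 2 * q * Real.log (t / 2) < 0 := by
  obtain ⟨t, ht, ht'⟩ : ∃ t : ℝ, 2 < t ∧ t * p < 2 * q := by
    rcases le_or_gt p 0 with hp | hp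
    · exact ⟨3, by norm_num, by linarith⟩
    · obtain ⟨t, h1, h2⟩ := exists_between ((lt_div_iff₀ hp).2 (by linarith) : 2 < 2 * q / p)
      exact ⟨t, h1, (lt_div_iff₀ hp).1 h2⟩
  have hlog := Real.one_sub_inv_le_log_of_pos (by linarith : 0 < t / 2)
  refine ⟨t, ht, ?_⟩
  have h3 : 2 * q * (1 - (t / 2)⁻¹) ≤ 2 * q * Real.log (t / 2) :=
    mul_le_mul_of_nonneg_left hlog (by linarith)
  have h4 : (t - 2) * p - 2 * q * (1 - (t / 2)⁻¹) = (t - 2) * (t * p - 2 * q) / t := by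
    have : t ≠ 0 := by linarith
    field_simp
  have h5 : (t - 2) * (t * p - 2 * q) / t < 0 :=
    div_neg_of_neg_of_pos (mul_neg_of_pos_of_neg (by linarith) (by linarith)) (by linarith)
  linarith

theorem rpow_mul_log {v x : ℝ} (hv : 0 < v) (hx : 0 < x) (c : ℝ) :
    v ^ (c * Real.log x) = x ^ (c * Real.log v) := by
  rw [Real.rpow_def_of_pos hv, Real.rpow_def_of_pos hx]
  ring_nf

theorem tendsto_natCast_rpow_neg {r : ℝ} (hr : r < 0) :
    Tendsto (fun n : ℕ => (n : ℝ) ^ r) atTop (nhds 0) := by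
  have := (tendsto_rpow_neg_atTop (neg_pos.2 hr)).comp tendsto_natCast_atTop_atTop
  simpa [Function.comp_def] using this

/-! ### Asymptotic bounds for the maximal degree -/

section Limits

variable {Ω : Type*} [MeasurableSpace Ω] {μ : Measure Ω} [IsProbabilityMeasure μ]
  {f : ℕ → ℝ} {E : ℕ → Ω → ℕ}

/-- If the exponent of the union bound is negative, with high probability no vertex of the set
`S n` has degree at least `c * log n`. -/
theorem tendsto_measureReal_exists_le_treeDegree (hf : ∀ k, f k = 1)
    (hE : IsAttachmentTree μ f E) {t a c K : ℝ} (ht : 1 < t)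
    (hexp : t - 1 + a * (2 - t) - c * Real.log t < 0) {S : ℕ → Set ℕ} (hK : 0 ≤ K)
    (hS : ∀ n : ℕ, 1 ≤ n → ∀ i ∈ S n, ((i : ℝ) + 1) ^ (2 - t) ≤ K * (n : ℝ) ^ (a * (2 - t))) :
    Tendsto (fun n : ℕ => μ.real {ω | ∃ i ∈ S n, i ≤ n ∧
      c * Real.log n ≤ treeDegree (fun k => E k ω) n i}) atTop (nhds 0) := by
  have ht0 : 0 < t := by linarith
  set r := t - 1 + a * (2 - t) - c * Real.log t with hr
  have hlim : Tendsto (fun n : ℕ => t ^ (2 : ℝ) * 2 ^ (t - 1) * K *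
      ((1 + Real.log 2) * (n : ℝ) ^ r + Real.log n / (n : ℝ) ^ (-r))) atTop (nhds 0) := by
    have h1 := tendsto_natCast_rpow_neg hexp
    have h2 := ((isLittleO_log_rpow_atTop (neg_pos.2 hexp)).tendsto_div_nhds_zero).comp
      tendsto_natCast_atTop_atTop
    simpa using ((h1.const_mul (1 + Real.log 2)).add h2).const_mul (t ^ (2 : ℝ) * 2 ^ (t - 1) * K)
  refine tendsto_of_tendsto_of_tendsto_of_le_of_le' tendsto_const_nhds hlim
    (Eventually.of_forall fun n => measureReal_nonneg) ?_
  filter_upwards [eventually_ge_atTop 1] with n hn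
  have hn1 : (1 : ℝ) ≤ n := by exact_mod_cast hn
  have hn0 : (0 : ℝ) < n := by linarith
  refine (measureReal_exists_le_treeDegree_le hf hE ht _ (fun i hi _ => hS n hn i hi)
    (by positivity)).trans ?_
  have e1 : t ^ (2 - c * Real.log n) = t ^ (2 : ℝ) * (n : ℝ) ^ (-(c * Real.log t)) := by
    rw [sub_eq_add_neg, Real.rpow_add ht0, ← neg_mul, rpow_mul_log ht0 hn0, neg_mul]
  have e2 : ((n : ℝ) + 1) ^ (t - 1) ≤ 2 ^ (t - 1) * (n : ℝ) ^ (t - 1) := by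
    rw [← Real.mul_rpow (by norm_num) hn0.le]
    exact Real.rpow_le_rpow (by positivity) (by linarith) (by linarith)
  have e3 : Real.log ((n : ℝ) + 1) ≤ Real.log 2 + Real.log n := by
    rw [← Real.log_mul (by norm_num) hn0.ne']
    exact Real.log_le_log (by positivity) (by linarith)
  have e4 : (n : ℝ) ^ r =
      (n : ℝ) ^ (-(c * Real.log t)) * (n : ℝ) ^ (t - 1) * (n : ℝ) ^ (a * (2 - t)) := by
    rw [← Real.rpow_add hn0, ← Real.rpow_add hn0, hr]
    ring_nf
  have e5 : 0 ≤ 1 + Real.log ((n : ℝ) + 1) := by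
    linarith [Real.log_nonneg (by linarith : (1 : ℝ) ≤ n + 1)]
  calc _ ≤ t ^ (2 : ℝ) * (n : ℝ) ^ (-(c * Real.log t)) * (2 ^ (t - 1) * (n : ℝ) ^ (t - 1)) *
        (K * (n : ℝ) ^ (a * (2 - t))) * (1 + (Real.log 2 + Real.log n)) := by
        rw [e1]; gcongr
    _ = _ := by
        rw [Real.rpow_neg hn0.le r, div_inv_eq_mul, e4]; ring

/-- With high probability the maximal degree is at least `c * log n` for `c < 1 / log 2`.  The
vertices of degree about `b * log n` are found among the oldest `n ^ (1 - b / 2)` ones. -/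
theorem tendsto_measureReal_maxDegree_lt (hf : ∀ k, f k = 1) (hE : IsAttachmentTree μ f E)
    {c : ℝ} (hc : 0 < c) (hc2 : c < 1 / Real.log 2) :
    Tendsto (fun n : ℕ => μ.real {ω | (maxDegree (fun k => E k ω) n : ℝ) < c * Real.log n})
      atTop (nhds 0) := by
  have hl0 : 0 < Real.log 2 := Real.log_pos one_lt_two
  have hl2 : 1 / Real.log 2 < 2 := by
    rw [div_lt_iff₀ hl0]; linarith [Real.log_two_gt_d9]
  obtain ⟨b, hcb, hb⟩ := exists_between hc2
  obtain ⟨y, hby, hy⟩ := exists_between hb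
  have hy1 : y * Real.log 2 < 1 := (lt_div_iff₀ hl0).1 hy
  obtain ⟨t, ht1, ht2, ht⟩ := exists_tilt_lt_two (p := b / 2) (q := c / 2) (by linarith)
    (by linarith)
  obtain ⟨u, hu2, hu⟩ := exists_two_lt_tilt (p := b / 2) (q := y / 2) (by linarith)
    (by linarith)
  have ht0 : 0 < t := by linarith
  have hu0 : 0 < u := by linarith
  have herr1 := tendsto_natCast_rpow_neg ht
  have herr2 := (tendsto_natCast_rpow_neg hu).const_mul (2 ^ (u - 2))
  rw [mul_zero] at herr2
  have hlim : Tendsto (fun n : ℕ => 4 * (n : ℝ) ^ (y * Real.log 2 - 1)) atTop (nhds 0) := by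
    simpa using (tendsto_natCast_rpow_neg (by linarith : y * Real.log 2 - 1 < 0)).const_mul 4
  refine tendsto_of_tendsto_of_tendsto_of_le_of_le' tendsto_const_nhds hlim
    (Eventually.of_forall fun n => measureReal_nonneg) ?_
  filter_upwards [eventually_ge_atTop 1,
    herr1.eventually_le_const (by norm_num : (0 : ℝ) < 1 / 8),
    herr2.eventually_le_const (by norm_num : (0 : ℝ) < 1 / 8)] with n hn he1 he2
  have hn1 : (1 : ℝ) ≤ n := by exact_mod_cast hn
  have hn0 : (0 : ℝ) < n := by linarith
  set z : ℝ := (n : ℝ) ^ (1 - b / 2) with hz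
  have hz1 : 1 ≤ z := Real.one_le_rpow hn1 (by linarith)
  have hzn : z ≤ n := by
    simpa using Real.rpow_le_rpow_of_exponent_le hn1 (by linarith : 1 - b / 2 ≤ 1)
  set M := ⌊z⌋₊ with hMdef
  have hM : 1 ≤ M := Nat.le_floor (by simpa using hz1)
  have hMn : M ≤ n := by
    have := Nat.floor_le_floor hzn
    simpa using this
  have hM1 : (1 : ℝ) ≤ M := by exact_mod_cast hM
  have hM0 : (0 : ℝ) < M := by linarith
  have hMz : (M : ℝ) ≤ z := Nat.floor_le (by linarith)
  have hzM : z ≤ 2 * M := by linarith [Nat.lt_floor_add_one z]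
  set ρ : ℝ := (n : ℝ) / M with hρ
  have hρ0 : 0 < ρ := by positivity
  have hnz : (n : ℝ) = (n : ℝ) ^ (b / 2) * z := by
    rw [hz, ← Real.rpow_add hn0, add_sub_cancel, Real.rpow_one]
  have hw0 : (0 : ℝ) < (n : ℝ) ^ (b / 2) := by positivity
  have hρ1 : (n : ℝ) ^ (b / 2) ≤ ρ := by
    rw [hρ, le_div_iff₀ hM0]
    calc _ ≤ (n : ℝ) ^ (b / 2) * z := by gcongr
      _ = n := hnz.symm
  have hρ2 : ρ ≤ 2 * (n : ℝ) ^ (b / 2) := by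
    rw [hρ, div_le_iff₀ hM0]
    calc (n : ℝ) = (n : ℝ) ^ (b / 2) * z := hnz
      _ ≤ (n : ℝ) ^ (b / 2) * (2 * M) := by gcongr
      _ = _ := by ring
  -- the two error terms of the tilting bound, divided by `ρ`
  have h1 : (2 / t) ^ (c * Real.log n) * ρ ^ (t - 2) ≤ 1 / 8 := by
    refine le_trans ?_ he1
    have : ρ ^ (t - 2) ≤ ((n : ℝ) ^ (b / 2)) ^ (t - 2) :=
      Real.rpow_le_rpow_of_nonpos hw0 hρ1 (by linarith)
    calc _ ≤ (2 / t) ^ (c * Real.log n) * ((n : ℝ) ^ (b / 2)) ^ (t - 2) := by gcongr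
      _ = _ := by
        rw [rpow_mul_log (by positivity) hn0, ← Real.rpow_mul hn0.le, ← Real.rpow_add hn0,
          Real.log_div (by norm_num) ht0.ne', Real.log_div ht0.ne' (by norm_num)]
        ring_nf
  have h2 : (2 / u) ^ (y * Real.log n) * ρ ^ (u - 2) ≤ 1 / 8 := by
    refine le_trans ?_ he2
    have : ρ ^ (u - 2) ≤ (2 * (n : ℝ) ^ (b / 2)) ^ (u - 2) :=
      Real.rpow_le_rpow hρ0.le hρ2 (by linarith)
    calc _ ≤ (2 / u) ^ (y * Real.log n) * (2 * (n : ℝ) ^ (b / 2)) ^ (u - 2) := by gcongr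
      _ = _ := by
        rw [rpow_mul_log (by positivity) hn0, Real.mul_rpow (by norm_num) hw0.le,
          ← Real.rpow_mul hn0.le, mul_left_comm, ← Real.rpow_add hn0,
          Real.log_div (by norm_num) hu0.ne', Real.log_div hu0.ne' (by norm_num)]
        ring_nf
  have hsucc : ∀ s : ℝ, ρ ^ (s - 1) = ρ ^ (s - 2) * ρ := by
    intro s
    nth_rewrite 3 [← Real.rpow_one ρ]
    rw [← Real.rpow_add hρ0]
    ring_nf
  have hq0 : (0 : ℝ) < 2 ^ (y * Real.log n) := by positivity
  have hp : ∀ i < M, ρ / (4 * 2 ^ (y * Real.log n)) ≤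
      μ.real {ω | c * Real.log n ≤ edgesInto (fun k => E k ω) M n i} := by
    intro i hi
    have h3 := div_le_rpow_mul_measureReal_add hf hE hM hi.le hMn (x := c * Real.log n)
      (y := y * Real.log n) ht1 ht2 hu2
    have h4 : ρ / 2 ≤ ((n : ℝ) + 1) / (M + 1) := by
      rw [hρ, div_div, div_le_div_iff₀ (by positivity) (by positivity)]
      nlinarith
    rw [← hρ, hsucc, hsucc, ← mul_assoc, ← mul_assoc] at h3
    have h5 := mul_le_mul_of_nonneg_right h1 hρ0.le
    have h6 := mul_le_mul_of_nonneg_right h2 hρ0.le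
    rw [div_le_iff₀ (by positivity)]
    linarith
  have h7 := mul_measureReal_forall_treeDegree_lt_le_one hf hE hMn hp
  have h8 : (M : ℝ) * (ρ / (4 * 2 ^ (y * Real.log n))) = (4 * (n : ℝ) ^ (y * Real.log 2 - 1))⁻¹ := by
    rw [rpow_mul_log (by norm_num) hn0, Real.rpow_sub_one hn0.ne', hρ]
    field_simp
  rw [h8, inv_mul_le_iff₀ (by positivity), mul_one] at h7
  refine (measureReal_mono ?_).trans h7
  intro ω hω i hi
  have h9 : (treeDegree (fun k => E k ω) n i : ℝ) ≤ maxDegree (fun k => E k ω) n := by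
    exact_mod_cast treeDegree_le_maxDegree _ (hi.le.trans hMn)
  exact h9.trans_lt hω

/-! ### The index of the hub -/

/-- With high probability the hub is not in `S n`, if some exponential moment rules out the degree
`log n / log 2` on `S n`. -/
theorem tendsto_measureReal_hubIndex_mem (hf : ∀ k, f k = 1) (hE : IsAttachmentTree μ f E)
    {t a K : ℝ} (ht : 1 < t)
    (hexp : (t - 2) * (1 - a) - 2 * (1 / (2 * Real.log 2)) * Real.log (t / 2) < 0)
    {S : ℕ → Set ℕ} (hK : 0 ≤ K)
    (hS : ∀ n : ℕ, 1 ≤ n → ∀ i ∈ S n, ((i : ℝ) + 1) ^ (2 - t) ≤ K * (n : ℝ) ^ (a * (2 - t))) :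
    Tendsto (fun n : ℕ => μ.real {ω | hubIndex (fun k => E k ω) n ∈ S n}) atTop (nhds 0) := by
  have hl0 : 0 < Real.log 2 := Real.log_pos one_lt_two
  have hlt : 0 < Real.log t := Real.log_pos ht
  have h1 : (t - 1 + a * (2 - t)) / Real.log t < 1 / Real.log 2 := by
    rw [div_lt_iff₀ hlt]
    rw [Real.log_div (by linarith) (by norm_num)] at hexp
    have : 2 * (1 / (2 * Real.log 2)) * (Real.log t - Real.log 2) =
        1 / Real.log 2 * Real.log t - 1 := by field_simp
    rw [this] at hexp
    linarith
  obtain ⟨c, hc1, hc2⟩ := exists_between (max_lt h1 (one_div_pos.2 hl0))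
  have hc0 : 0 < c := (le_max_right _ _).trans_lt hc1
  have hc3 := (div_lt_iff₀ hlt).1 ((le_max_left _ _).trans_lt hc1)
  have hlim := (tendsto_measureReal_exists_le_treeDegree hf hE ht (by linarith) hK hS).add
    (tendsto_measureReal_maxDegree_lt hf hE hc0 hc2)
  rw [add_zero] at hlim
  refine squeeze_zero (fun n => measureReal_nonneg) (fun n => ?_) hlim
  refine (measureReal_mono fun ω hω => ?_).trans (measureReal_union_le _ _)
  obtain ⟨h2, h3⟩ := hubIndex_spec (fun k => E k ω) n
  rcases lt_or_ge (maxDegree (fun k => E k ω) n : ℝ) (c * Real.log n) with h | h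
  · exact Or.inr h
  · exact Or.inl ⟨_, hω, h2, by rw [h3]; exact h⟩

theorem tendsto_measureReal_hubIndex_le (hf : ∀ k, f k = 1) (hE : IsAttachmentTree μ f E)
    {a : ℝ} (ha0 : 0 ≤ a) (ha : a < 1 - 1 / (2 * Real.log 2)) :
    Tendsto (fun n : ℕ => μ.real {ω | (hubIndex (fun k => E k ω) n : ℝ) ≤ (n : ℝ) ^ a})
      atTop (nhds 0) := by
  have hl0 : 0 < Real.log 2 := Real.log_pos one_lt_two
  obtain ⟨t, ht1, ht2, ht⟩ := exists_tilt_lt_two (p := 1 - a) (q := 1 / (2 * Real.log 2))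
    (by positivity) (by linarith)
  refine tendsto_measureReal_hubIndex_mem hf hE (S := fun n => {i | (i : ℝ) ≤ (n : ℝ) ^ a})
    (K := 2 ^ (2 - t)) ht1 ht (by positivity) fun n hn i hi => ?_
  have hn1 : (1 : ℝ) ≤ n := by exact_mod_cast hn
  have h1 : (1 : ℝ) ≤ (n : ℝ) ^ a := Real.one_le_rpow hn1 ha0
  have h2 : (i : ℝ) ≤ (n : ℝ) ^ a := hi
  rw [Real.rpow_mul (by linarith), ← Real.mul_rpow (by norm_num) (by linarith)]
  exact Real.rpow_le_rpow (by positivity) (by linarith) (by linarith)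

theorem tendsto_measureReal_le_hubIndex (hf : ∀ k, f k = 1) (hE : IsAttachmentTree μ f E)
    {a : ℝ} (ha : 1 - 1 / (2 * Real.log 2) < a) :
    Tendsto (fun n : ℕ => μ.real {ω | (n : ℝ) ^ a ≤ hubIndex (fun k => E k ω) n})
      atTop (nhds 0) := by
  have hl0 : 0 < Real.log 2 := Real.log_pos one_lt_two
  obtain ⟨t, ht2, ht⟩ := exists_two_lt_tilt (p := 1 - a) (q := 1 / (2 * Real.log 2))
    (by positivity) (by linarith)
  refine tendsto_measureReal_hubIndex_mem hf hE (S := fun n => {i | (n : ℝ) ^ a ≤ (i : ℝ)})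
    (K := 1) (by linarith) ht zero_le_one fun n hn i hi => ?_
  have hn0 : (0 : ℝ) < n := by exact_mod_cast hn
  have h2 : (n : ℝ) ^ a ≤ i := hi
  rw [Real.rpow_mul hn0.le, one_mul]
  exact Real.rpow_le_rpow_of_nonpos (by positivity) (by linarith) (by linarith)

/-- With high probability the maximal degree is less than `c * log n` for `c > 1 / log 2`. -/
theorem tendsto_measureReal_le_maxDegree (hf : ∀ k, f k = 1) (hE : IsAttachmentTree μ f E)
    {c : ℝ} (hc : 1 / Real.log 2 < c) :
    Tendsto (fun n : ℕ => μ.real {ω | c * Real.log n ≤ maxDegree (fun k => E k ω) n})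
      atTop (nhds 0) := by
  have hc1 := (div_lt_iff₀ (Real.log_pos one_lt_two)).1 hc
  refine squeeze_zero (fun n => measureReal_nonneg) (fun n => ?_)
    (tendsto_measureReal_exists_le_treeDegree hf hE (t := 2) (a := 0) (c := c) (K := 1)
      (S := fun _ => Set.univ) one_lt_two (by linarith) zero_le_one (by simp))
  refine measureReal_mono fun ω hω => ?_
  obtain ⟨i, hi, h⟩ := exists_treeDegree_eq_maxDegree (fun k => E k ω) n
  exact ⟨i, trivial, hi, by rw [h]; exact hω⟩

end Limits

/-! ### Convergence in probability -/

theorem theorem4p12 {Ω : Type*} [MeasurableSpace Ω] (μ : Measure Ω) [IsProbabilityMeasure μ]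
    (f : ℕ → ℝ) (hf : ∀ k, f k = 1) (E : ℕ → Ω → ℕ) (hE : IsAttachmentTree μ f E) :
    TendstoInMeasure μ
        (fun (n : ℕ) ω => Real.log (hubIndex (fun k => E k ω) n : ℝ) / Real.log (n : ℝ))
        atTop (fun _ => 1 - 1 / (2 * Real.log 2)) ∧
      TendstoInMeasure μ
        (fun (n : ℕ) ω => (maxDegree (fun k => E k ω) n : ℝ) / Real.log (n : ℝ))
        atTop (fun _ => 1 / Real.log 2) := by
  have hl0 : 0 < Real.log 2 := Real.log_pos one_lt_two
  have hstar : 0 < 1 - 1 / (2 * Real.log 2) := by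
    rw [sub_pos, div_lt_one (by positivity)]
    linarith [Real.log_two_gt_d9]
  constructor
  · refine tendstoInMeasure_iff_measureReal_norm.2 fun ε hε => ?_
    -- the bound for old hubs needs a nonnegative exponent
    set δ := min ε (1 - 1 / (2 * Real.log 2)) with hδ
    have hδ0 : 0 < δ := lt_min hε hstar
    have hδε : δ ≤ ε := min_le_left _ _
    have hδs : δ ≤ 1 - 1 / (2 * Real.log 2) := min_le_right _ _
    have hlim := (tendsto_measureReal_hubIndex_le hf hE
      (a := 1 - 1 / (2 * Real.log 2) - δ) (by linarith) (by linarith)).add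
      (tendsto_measureReal_le_hubIndex hf hE
      (a := 1 - 1 / (2 * Real.log 2) + ε) (by linarith))
    rw [add_zero] at hlim
    refine tendsto_of_tendsto_of_tendsto_of_le_of_le' tendsto_const_nhds hlim
      (Eventually.of_forall fun n => measureReal_nonneg) ?_
    filter_upwards [eventually_gt_atTop 1] with n hn
    have hn1 : (1 : ℝ) < n := by exact_mod_cast hn
    have hn0 : (0 : ℝ) < n := by linarith
    have hL : 0 < Real.log n := Real.log_pos hn1
    refine (measureReal_mono fun ω hω => ?_).trans (measureReal_union_le _ _)
    have hω' : ε ≤ |Real.log (hubIndex (fun k => E k ω) n : ℝ) / Real.log (n : ℝ) -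
      (1 - 1 / (2 * Real.log 2))| := hω
    -- `log 0 = 0`, so the index `0` is treated apart
    rcases Nat.eq_zero_or_pos (hubIndex (fun k => E k ω) n) with h0 | h0
    · refine Or.inl ?_
      show (hubIndex (fun k => E k ω) n : ℝ) ≤ _
      rw [h0, Nat.cast_zero]
      positivity
    have h0' : (0 : ℝ) < hubIndex (fun k => E k ω) n := by exact_mod_cast h0
    rcases le_abs.1 hω' with h | h
    · refine Or.inr ?_
      show _ ≤ (hubIndex (fun k => E k ω) n : ℝ)
      rw [Real.rpow_le_iff_le_log hn0 h0', ← le_div_iff₀ hL]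
      linarith
    · refine Or.inl ?_
      show (hubIndex (fun k => E k ω) n : ℝ) ≤ _
      rw [Real.le_rpow_iff_log_le h0' hn0, ← div_le_iff₀ hL]
      linarith
  · refine tendstoInMeasure_iff_measureReal_norm.2 fun ε hε => ?_
    obtain ⟨c, hc1, hc2⟩ := exists_between (max_lt (sub_lt_self (1 / Real.log 2) hε)
      (one_div_pos.2 hl0))
    have hlim := (tendsto_measureReal_maxDegree_lt hf hE ((le_max_right _ _).trans_lt hc1)
      hc2).add (tendsto_measureReal_le_maxDegree hf hE (c := 1 / Real.log 2 + ε) (by linarith))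
    rw [add_zero] at hlim
    refine tendsto_of_tendsto_of_tendsto_of_le_of_le' tendsto_const_nhds hlim
      (Eventually.of_forall fun n => measureReal_nonneg) ?_
    filter_upwards [eventually_gt_atTop 1] with n hn
    have hL : 0 < Real.log n := Real.log_pos (by exact_mod_cast hn)
    refine (measureReal_mono fun ω hω => ?_).trans (measureReal_union_le _ _)
    have hω' : ε ≤ |(maxDegree (fun k => E k ω) n : ℝ) / Real.log (n : ℝ) - 1 / Real.log 2| := hω
    have hc3 := (le_max_left _ _).trans_lt hc1
    rcases le_abs.1 hω' with h | h
    · refine Or.inr ?_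
      show _ ≤ (maxDegree (fun k => E k ω) n : ℝ)
      rw [← le_div_iff₀ hL]
      linarith
    · refine Or.inl ?_
      show (maxDegree (fun k => E k ω) n : ℝ) < _
      rw [← div_lt_iff₀ hL]
      linarith
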